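/- Let $(A_i)_{i\in\mathbb{N}}$ be a sequence of finite sets with $|A_i|\ge 2$ for all $i$, and let $T$ be the associated spherically homogeneous rooted tree: its vertices are the finite words $a_0a_1\cdots a_{k-1}$ with $a_i\in A_i$ and $k\ge 0$, its root is the empty word, and every word is joined by an edge to each of its extensions by exactly one letter. The words of length $n$ form the $n$-th level of $T$. Let $\mathrm{Aut}(T)$ be the group of graph automorphisms of $T$ that fix the root. For a subgroup $G\le\mathrm{Aut}(T)$ and a vertex $v$, let $\mathrm{rist}_G(v)$ be the subgroup of all elements of $G$ that fix every vertex not having $v$ as a prefix, and let $\mathrm{rist}_G(n)$ be the subgroup of $G$ generated by the subgroups $\mathrm{rist}_G(v)$ for all $v$ in the $n$-th level. The group $G$ is called a branch group if it acts transitively on every level of $T$ and $\mathrm{rist}_G(n)$ has finite index in $G$ for every $n\in\mathbb{N}$. An action of a group $G$ on a set $X$ is called quasi-$2$-transitive if the diagonal action of $G$ on $X^2$ has only finitely many orbits. Theorem. A branch group cannot act quasi-$2$-transitively on an infinite set. That is, if $G\le\mathrm{Aut}(T)$ is a branch group acting in any way on an infinite set $X$, then the diagonal action of $G$ on $X^2$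 has infinitely many orbits. -/

import Mathlib

universe u v

namespace RootedTree

/-- The words in a sequence of alphabets: a word of length `k` is an element of
`A 0 × A 1 × ⋯ × A (k - 1)`. -/
def Word (A : ℕ → Type u) : Type u := Σ k : ℕ, (∀ i : Fin k, A i)

variable {A : ℕ → Type u}

/-- The length of a word. -/
def Word.length (x : Word A) : ℕ := x.1

/-- The empty word. -/
def Word.empty : Word A := ⟨0, fun i => i.elim0⟩

/-- `x` is a prefix of `y`. -/
def Word.IsPrefix (x y : Word A) : Prop :=
  ∃ h : x.length ≤ y.length, ∀ i : Fin x.length, y.2 (Fin.castLE h i) = x.2 i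

/-- `y` is a child of `x`: it extends `x` by exactly one letter. -/
def Word.IsChild (x y : Word A) : Prop :=
  x.IsPrefix y ∧ y.length = x.length + 1

variable (A) in
/-- The spherically homogeneous tree on the words in the alphabets `A`, rooted at the empty word:
edges join every word to its children. -/
def graph : SimpleGraph (Word A) where
  Adj x y := x.IsChild y ∨ y.IsChild x
  symm := ⟨fun _ _ h => h.symm⟩
  loopless := ⟨fun x h => by
    rcases h with h | h <;> exact absurd h.2 (by omega)⟩

variable (A) in
/-- The group of automorphisms of the rooted tree: graph automorphisms that fix the root. -/
def Aut : Subgroup (graph A ≃g graph A) where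
  carrier := {f | f Word.empty = Word.empty}
  one_mem' := rfl
  mul_mem' {f g} hf hg := by
    change f (g Word.empty) = Word.empty
    rw [show g Word.empty = Word.empty from hg]
    exact hf
  inv_mem' {f} hf := by
    change f.symm Word.empty = Word.empty
    exact (f.symm_apply_eq).2 (show f Word.empty = Word.empty from hf).symm

/-- `G` acts spherically transitively: it is transitive on every level of the tree. -/
def IsSphericallyTransitive (G : Subgroup (Aut A)) : Prop :=
  ∀ (n : ℕ) (x y : Word A), x.length = n → y.length = n → ∃ g ∈ G, g.1 x = y

/-- The rigid stabiliser of the vertex `x` in `G`, as a subgroup of `G`: the elements of `G` that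
fix every vertex which is not a descendant of `x`. -/
def rist (G : Subgroup (Aut A)) (x : Word A) : Subgroup G where
  carrier := {g | ∀ y : Word A, ¬ x.IsPrefix y → g.1.1 y = y}
  one_mem' _ _ := rfl
  mul_mem' {f g} hf hg y hy := by
    change f.1.1 (g.1.1 y) = y
    rw [hg y hy, hf y hy]
  inv_mem' {f} hf y hy := by
    change f.1.1.symm y = y
    exact (f.1.1.symm_apply_eq).2 (hf y hy).symm

/-- The rigid stabiliser of the `n`-th level in `G`: the subgroup of `G` generated by the rigid
stabilisers of all the vertices of the `n`-th level. -/
def levelRist (G : Subgroup (Aut A)) (n : ℕ) : Subgroup G :=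
  ⨆ (x : Word A) (_ : x.length = n), rist G x

/-- Branch groups. -/
structure IsBranchGroup (G : Subgroup (Aut A)) : Prop where
  sphericallyTransitive : IsSphericallyTransitive G
  finiteIndex_levelRist : ∀ n : ℕ, (levelRist G n).FiniteIndex

end RootedTree

/-- An action of `G` on `X` is quasi-`n`-transitive if the diagonal action of `G` on `Xⁿ` has only
finitely many orbits. -/
def IsQuasiTransitive (G : Type u) [Group G] (X : Type v) [MulAction G X] (n : ℕ) : Prop :=
  Finite (MulAction.orbitRel.Quotient G (Fin n → X))

/-! Suppose there are only `r` orbits of pairs. In a deep level the rigid stabilisers `R v` commute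
with each other and generate a normal subgroup `P` of finite index. The contradiction comes from
large subgroups `D v` of the `R v` that together act on `X` as an abelian group: an abelian action
with finitely many orbits on pairs lives on a finite set (`finite_of_commute_smul`).

The number of `P`-orbits on `X` is bounded independently of the level, because the orbit relation of
a normal subgroup is one of the finitely many invariant relations (`exists_bound_card_orbits`).
Within a `P`-orbit, at most `r` of the factors `R v` are needed to move between two points
(`exists_card_le_of_mem_supOver_univ`). B. H. Neumann's covering lemma then yields a set `S` of
vertices, of size bounded independently of the level, whose `R v` already generate a group with
finitely many orbits (`exists_supOver_hasFinitelyManyOrbits`).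

If the level is large, every vertex `v` has two disjoint translates of `S` avoiding it. They give
groups `A` and `B` that commute with each other and with `R v`, each with finitely many orbits. The
elements of `R v` preserving all `A`-orbits and all `B`-orbits form `D v`; they commute on `X` by
`commute_smul_of_orbitPreserving`. Size is measured by `IsCoarselyDense`, which composes along
chains of subgroups. -/

/-! ### Group actions with finitely many orbits -/

section Actions

variable {G : Type*} [Group G] {X : Type*} [MulAction G X]

/-- The subgroup `D` has finitely many orbits on `X`. -/
def HasFinitelyManyOrbits (D : Subgroup G) (X : Type*) [MulAction G X] : Prop :=
  ∃ F : Set X, F.Finite ∧ ∀ y, ∃ f ∈ F, ∃ d ∈ D, d • f = y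

/-- The subgroup `P` is contained in finitely many right cosets of `D`. -/
def IsCoarselyDense (D P : Subgroup G) : Prop :=
  ∃ F : Set G, F.Finite ∧ ∀ p ∈ P, ∃ d ∈ D, ∃ t ∈ F, d * t = p

theorem IsCoarselyDense.trans {A B C : Subgroup G} (h₁ : IsCoarselyDense A B)
    (h₂ : IsCoarselyDense B C) : IsCoarselyDense A C := by
  obtain ⟨F₁, hF₁, h₁⟩ := h₁
  obtain ⟨F₂, hF₂, h₂⟩ := h₂
  refine ⟨Set.image2 (· * ·) F₁ F₂, hF₁.image2 _ hF₂, fun p hp => ?_⟩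
  obtain ⟨b, hb, t, ht, rfl⟩ := h₂ p hp
  obtain ⟨a, ha, s, hs, rfl⟩ := h₁ b hb
  exact ⟨a, ha, s * t, Set.mem_image2_of_mem hs ht, by group⟩

theorem IsCoarselyDense.hasFinitelyManyOrbits {A B : Subgroup G} (h₁ : IsCoarselyDense A B)
    (h₂ : HasFinitelyManyOrbits B X) : HasFinitelyManyOrbits A X := by
  obtain ⟨F₁, hF₁, h₁⟩ := h₁
  obtain ⟨F₂, hF₂, h₂⟩ := h₂
  refine ⟨Set.image2 (· • ·) F₁ F₂, hF₁.image2 _ hF₂, fun y => ?_⟩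
  obtain ⟨f, hf, b, hb, rfl⟩ := h₂ y
  obtain ⟨a, ha, s, hs, rfl⟩ := h₁ b hb
  exact ⟨s • f, Set.mem_image2_of_mem hs hf, a, ha, smul_smul _ _ _⟩

theorem isCoarselyDense_top_of_finiteIndex (P : Subgroup G) [P.FiniteIndex] :
    IsCoarselyDense P ⊤ := by
  refine ⟨Set.range fun q : G ⧸ P => q.out⁻¹, Set.finite_range _, fun p _ => ?_⟩
  refine ⟨p * ((p⁻¹ : G) : G ⧸ P).out, ?_, _, ⟨((p⁻¹ : G) : G ⧸ P), rfl⟩, by simp⟩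
  have h : ((p⁻¹ : G) : G ⧸ P) = (((p⁻¹ : G) : G ⧸ P).out : G) := by simp
  simpa using QuotientGroup.eq.1 h

theorem isCoarselyDense_of_fibers {ι : Type*} [Finite ι] {D C : Subgroup G} (φ : G → ι)
    (h : ∀ c ∈ C, ∀ c' ∈ C, φ c = φ c' → c * c'⁻¹ ∈ D) : IsCoarselyDense D C := by
  classical
  have key : ∀ i, ∃ t, (∃ c ∈ C, φ c = i) → t ∈ C ∧ φ t = i := fun i => by
    by_cases hi : ∃ c ∈ C, φ c = i
    · exact ⟨hi.choose, fun _ => hi.choose_spec⟩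
    · exact ⟨1, fun h' => absurd h' hi⟩
  choose t ht using key
  refine ⟨Set.range t, Set.finite_range _, fun p hp => ?_⟩
  obtain ⟨h₁, h₂⟩ := ht (φ p) ⟨p, hp, rfl⟩
  exact ⟨p * (t (φ p))⁻¹, h p hp _ h₁ h₂.symm, _, ⟨φ p, rfl⟩, by group⟩

/-- The elements of `C` that preserve every orbit of `A`. -/
def orbitPreserving (C A : Subgroup G) (X : Type*) [MulAction G X] : Subgroup G where
  carrier := {c | c ∈ C ∧ ∀ x : X, ∃ a ∈ A, a • x = c • x}
  one_mem' := ⟨C.one_mem, fun x => ⟨1, A.one_mem, rfl⟩⟩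
  mul_mem' {c d} hc hd := by
    refine ⟨C.mul_mem hc.1 hd.1, fun x => ?_⟩
    obtain ⟨a, ha, hax⟩ := hd.2 x
    obtain ⟨b, hb, hbx⟩ := hc.2 (d • x)
    exact ⟨b * a, A.mul_mem hb ha, by rw [mul_smul, hax, hbx, mul_smul]⟩
  inv_mem' {c} hc := by
    refine ⟨C.inv_mem hc.1, fun x => ?_⟩
    obtain ⟨a, ha, hax⟩ := hc.2 (c⁻¹ • x)
    refine ⟨a⁻¹, A.inv_mem ha, ?_⟩
    rw [inv_smul_eq_iff, hax, smul_inv_smul]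

/-- Since `C` commutes with `A`, it permutes the finitely many `A`-orbits, and the kernel of this
permutation action has finite index in `C`. -/
theorem isCoarselyDense_orbitPreserving {C A : Subgroup G} (hA : HasFinitelyManyOrbits A X)
    (hcomm : ∀ a ∈ A, ∀ c ∈ C, a * c = c * a) :
    IsCoarselyDense (orbitPreserving C A X) C := by
  obtain ⟨F, hF, hFX⟩ := hA
  have := hF.to_subtype
  choose rep hrep hrep' using hFX
  -- The map records how `c⁻¹` permutes the orbits. `rep` need not be constant on orbits; equal
  -- values only have to force equal orbits.
  refine isCoarselyDense_of_fibers (fun (c : G) (f : F) => (⟨rep (c⁻¹ • (f : X)), hrep _⟩ : F))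
    fun c hc c' hc' h => ?_
  have hin : c' * c⁻¹ ∈ orbitPreserving C A X := by
    refine ⟨C.mul_mem hc' (C.inv_mem hc), fun x => ?_⟩
    obtain ⟨a₁, ha₁, hx⟩ := hrep' x
    have hf := congrArg Subtype.val (congrFun h ⟨rep x, hrep x⟩)
    dsimp only at hf
    obtain ⟨b, hb, hbx⟩ := hrep' (c⁻¹ • rep x)
    obtain ⟨b', hb', hbx'⟩ := hrep' (c'⁻¹ • rep x)
    rw [← hf] at hbx'
    have e : c⁻¹ • rep x = b • b'⁻¹ • c'⁻¹ • rep x := by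
      rw [← hbx', inv_smul_smul, hbx]
    refine ⟨a₁ * (b * b'⁻¹) * a₁⁻¹, ?_, ?_⟩
    · exact A.mul_mem (A.mul_mem ha₁ (A.mul_mem hb (A.inv_mem hb'))) (A.inv_mem ha₁)
    · have h₁ := hcomm a₁ ha₁ _ (C.mul_mem hc' (C.inv_mem hc))
      have h₂ := hcomm _ (A.mul_mem hb (A.inv_mem hb')) _ hc'
      rw [← hx, smul_smul, smul_smul, ← h₁, mul_smul, mul_smul a₁, mul_smul c', e,
        smul_smul b, smul_smul c', ← h₂]
      simp [mul_smul]
  simpa using inv_mem hin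

/-- At `x`, `c` acts like some `b` in `B` and `c'` like some `a` in `A`. Commuting `c` past `a` and
`c'` past `b` turns the two sides into `a • b • x` and `b • a • x`. -/
theorem commute_smul_of_orbitPreserving {A B C : Subgroup G}
    (hAB : ∀ a ∈ A, ∀ b ∈ B, a * b = b * a) (hAC : ∀ a ∈ A, ∀ c ∈ C, a * c = c * a)
    (hBC : ∀ b ∈ B, ∀ c ∈ C, b * c = c * b) {c c' : G} (hc : c ∈ orbitPreserving C B X)
    (hc' : c' ∈ orbitPreserving C A X) (x : X) : c • c' • x = c' • c • x := by
  obtain ⟨b, hb, hbx⟩ := hc.2 x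
  obtain ⟨a, ha, hax⟩ := hc'.2 x
  rw [← hax, ← hbx, smul_smul, smul_smul, ← hAC a ha c hc.1, ← hBC b hb c' hc'.1, mul_smul,
    mul_smul, ← hax, ← hbx, smul_smul, smul_smul, hAB a ha b hb]

theorem exists_mul_eq_of_mem_sup {A B : Subgroup G} (hAB : ∀ a ∈ A, ∀ b ∈ B, a * b = b * a)
    {g : G} (hg : g ∈ A ⊔ B) : ∃ a ∈ A, ∃ b ∈ B, a * b = g := by
  let K : Subgroup G :=
    { carrier := {g | ∃ a ∈ A, ∃ b ∈ B, a * b = g}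
      one_mem' := ⟨1, A.one_mem, 1, B.one_mem, one_mul 1⟩
      mul_mem' := by
        rintro _ _ ⟨a, ha, b, hb, rfl⟩ ⟨a', ha', b', hb', rfl⟩
        refine ⟨a * a', A.mul_mem ha ha', b * b', B.mul_mem hb hb', ?_⟩
        rw [mul_assoc, ← mul_assoc a', hAB a' ha' b hb]
        group
      inv_mem' := by
        rintro _ ⟨a, ha, b, hb, rfl⟩
        refine ⟨a⁻¹, A.inv_mem ha, b⁻¹, B.inv_mem hb, ?_⟩
        rw [hAB a ha b hb, mul_inv_rev] }
  have hK : A ⊔ B ≤ K := sup_le (fun a ha => ⟨a, ha, 1, B.one_mem, mul_one a⟩)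
    fun b hb => ⟨1, A.one_mem, b, hb, one_mul b⟩
  exact hK hg

theorem IsCoarselyDense.sup {A B A' B' : Subgroup G} (hAB : ∀ a ∈ A, ∀ b ∈ B, a * b = b * a)
    (hA' : A' ≤ A) (hB' : B' ≤ B) (h₁ : IsCoarselyDense A' A) (h₂ : IsCoarselyDense B' B) :
    IsCoarselyDense (A' ⊔ B') (A ⊔ B) := by
  obtain ⟨F₁, hF₁, h₁⟩ := h₁
  obtain ⟨F₂, hF₂, h₂⟩ := h₂
  refine ⟨Set.image2 (· * ·) F₁ F₂, hF₁.image2 _ hF₂, fun p hp => ?_⟩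
  obtain ⟨a, ha, b, hb, rfl⟩ := exists_mul_eq_of_mem_sup hAB hp
  obtain ⟨a', ha', s, hs, rfl⟩ := h₁ a ha
  obtain ⟨b', hb', t, ht, rfl⟩ := h₂ b hb
  refine ⟨a' * b', mul_mem (Subgroup.mem_sup_left ha') (Subgroup.mem_sup_right hb'),
    _, Set.mem_image2_of_mem hs ht, ?_⟩
  have h := hAB (a' * s) ha b' (hB' hb')
  have h' := hAB a' (hA' ha') b' (hB' hb')
  rw [h', mul_assoc b', ← mul_assoc a', ← mul_assoc b', ← h]
  group

/-- By commutativity, an element of `D` fixing `x` fixes the whole `D`-orbit of `x`. So the pairs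
`(x, y)` with `y` in this orbit lie in distinct `D`-orbits, which makes every `D`-orbit on `X`
finite. -/
theorem finite_of_commute_smul {D : Subgroup G}
    (hD : ∀ d ∈ D, ∀ e ∈ D, ∀ x : X, d • e • x = e • d • x)
    (h : HasFinitelyManyOrbits D (Fin 2 → X)) : Finite X := by
  obtain ⟨F, hF, h⟩ := h
  have horb : ∀ x : X, {y : X | ∃ d ∈ D, d • x = y}.Finite := fun x => by
    choose rep hrep w hw hwx using h
    refine Set.Finite.of_finite_image (f := fun y => rep ![x, y])
      (hF.subset (by rintro _ ⟨y, -, rfl⟩; exact hrep _)) ?_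
    rintro y ⟨d, hd, rfl⟩ y' ⟨d', hd', rfl⟩ he
    dsimp only at he
    have h₁ := hwx ![x, d • x]
    have h₂ := hwx ![x, d' • x]
    rw [← he] at h₂
    set p := w ![x, d • x] with hp
    set q := w ![x, d' • x] with hq
    have hpD : p ∈ D := hw _
    have hqD : q ∈ D := hw _
    have h₃ : ∀ i, (p * q⁻¹) • (![x, d' • x] i) = ![x, d • x] i := fun i => by
      rw [← congrFun h₁ i, ← congrFun h₂ i, Pi.smul_apply, Pi.smul_apply, mul_smul, inv_smul_smul]
    have hx : (p * q⁻¹) • x = x := h₃ 0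
    have hy : (p * q⁻¹) • d' • x = d • x := h₃ 1
    rw [hD _ (mul_mem hpD (inv_mem hqD)) _ hd', hx] at hy
    exact hy.symm
  have hX : (Set.univ : Set X) ⊆ ⋃ f ∈ F, {y : X | ∃ d ∈ D, d • f 0 = y} := fun y _ => by
    obtain ⟨f, hf, d, hd, he⟩ := h ![y, y]
    exact Set.mem_biUnion hf ⟨d, hd, congrFun he 0⟩
  exact Set.finite_univ_iff.1 ((hF.biUnion fun f _ => horb (f 0)).subset hX)

open scoped Pointwise in
/-- If an orbit is covered by the orbits of finitely many normal subgroups through one point, then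
it consists of finitely many orbits of one of them. -/
theorem exists_orbit_finite_cover {ι : Type*} (s : Finset ι) (N : ι → Subgroup G)
    [∀ i, (N i).Normal] (x : X) (h : ∀ g : G, ∃ i ∈ s, ∃ a ∈ N i, a • x = g • x) :
    ∃ i ∈ s, ∃ F : Set X, F.Finite ∧ ∀ g : G, ∃ f ∈ F, ∃ a ∈ N i, a • f = g • x := by
  -- The hypothesis says that the subgroups `N i ⊔ stabilizer G x` cover `G`; by B. H. Neumann's
  -- lemma one of them has finite index.
  have hcov : ⋃ i ∈ s, (1 : G) • ((N i ⊔ MulAction.stabilizer G x : Subgroup G) : Set G) =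
      Set.univ := by
    refine Set.eq_univ_of_forall fun g => ?_
    obtain ⟨i, hi, a, ha, hax⟩ := h g
    refine Set.mem_biUnion hi ?_
    rw [one_smul, SetLike.mem_coe, show g = a * (a⁻¹ * g) by group]
    refine mul_mem (Subgroup.mem_sup_left ha) (Subgroup.mem_sup_right ?_)
    rw [MulAction.mem_stabilizer_iff, mul_smul, ← hax, inv_smul_smul]
  obtain ⟨i, hi, hfin⟩ := Subgroup.exists_finiteIndex_of_leftCoset_cover hcov
  obtain ⟨F, hF, hFG⟩ :=
    isCoarselyDense_top_of_finiteIndex (N i ⊔ MulAction.stabilizer G x : Subgroup G)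
  refine ⟨i, hi, (fun t => t⁻¹ • x) '' F, hF.image _, fun g => ?_⟩
  obtain ⟨d, hd, t, ht, hdt⟩ := hFG g⁻¹ trivial
  obtain ⟨y, hy, z, hz, hyz⟩ := Subgroup.mem_sup_of_normal_left.1 (inv_mem hd)
  refine ⟨_, Set.mem_image_of_mem _ ht, t⁻¹ * y * t⁻¹⁻¹,
    Subgroup.Normal.conj_mem inferInstance _ hy _, ?_⟩
  have hg : g = t⁻¹ * (y * z) := by rw [hyz, ← mul_inv_rev, hdt, inv_inv]
  rw [hg, mul_smul, mul_smul, inv_smul_smul, mul_smul, mul_smul, MulAction.mem_stabilizer_iff.1 hz]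

open scoped Pointwise in
-- The elements sending a given `s` to a given `t` form a coset of a point stabiliser, of index
-- `Nat.card Ω`. If no `g` worked, these `S.card * T.card` cosets would cover `G`, and one of the
-- subgroups would have index at most their number.
theorem exists_smul_disjoint_of_card_lt {Ω : Type*} [Finite Ω] [MulAction G Ω]
    [MulAction.IsPretransitive G Ω] [DecidableEq Ω] (S T : Finset Ω)
    (h : S.card * T.card < Nat.card Ω) : ∃ g : G, Disjoint (S.image (g • ·)) T := by
  by_contra! hcon
  choose k hk using fun p : Ω × Ω => MulAction.exists_smul_eq G p.1 p.2
  have hcov : ⋃ p ∈ S ×ˢ T, k p • (MulAction.stabilizer G p.1 : Set G) = Set.univ := by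
    refine Set.eq_univ_of_forall fun g => ?_
    obtain ⟨t, ht, htT⟩ := Finset.not_disjoint_iff.1 (hcon g)
    obtain ⟨s, hs, rfl⟩ := Finset.mem_image.1 ht
    refine Set.mem_biUnion (show (s, g • s) ∈ S ×ˢ T from Finset.mk_mem_product hs htT) ?_
    rw [mem_leftCoset_iff, SetLike.mem_coe, MulAction.mem_stabilizer_iff, mul_smul,
      inv_smul_eq_iff]
    exact (hk (s, g • s)).symm
  obtain ⟨p, -, -, hp⟩ := Subgroup.exists_index_le_card_of_leftCoset_cover hcov
  rw [MulAction.index_stabilizer_of_transitive, Finset.card_product] at hp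
  omega

end Actions

/-! ### Systems of commuting subgroups -/

/-! ### Invariant relations as sets of orbits of pairs -/

section PairOrbits

variable {G : Type*} [Group G] {X : Type*} [MulAction G X]

variable (G) in
/-- The set of orbits of pairs which are related by `r`. -/
def pairOrbits (r : X → X → Prop) : Set (MulAction.orbitRel.Quotient G (Fin 2 → X)) :=
  {q | ∃ x y, r x y ∧ Quotient.mk'' ![x, y] = q}

/-- An invariant relation can be recovered from its set of pair orbits, so finitely many pair orbits
leave only finitely many invariant relations. -/
theorem mk_mem_pairOrbits_iff {r : X → X → Prop} (hr : ∀ (g : G) x y, r x y → r (g • x) (g • y))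
    (x y : X) :
    (Quotient.mk'' ![x, y] : MulAction.orbitRel.Quotient G (Fin 2 → X)) ∈ pairOrbits G r ↔
      r x y := by
  refine ⟨?_, fun h => ⟨x, y, h, rfl⟩⟩
  rintro ⟨x', y', h, he⟩
  obtain ⟨g, hg⟩ := MulAction.orbitRel_apply.1 (Quotient.eq''.1 he.symm)
  have h₀ : g • x' = x := congrFun hg 0
  have h₁ : g • y' = y := congrFun hg 1
  rw [← h₀, ← h₁]
  exact hr g _ _ h

theorem pairOrbits_mono {r s : X → X → Prop} (h : ∀ x y, r x y → s x y) :
    pairOrbits G r ⊆ pairOrbits G s := by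
  rintro _ ⟨x, y, hr, rfl⟩
  exact ⟨x, y, h _ _ hr, rfl⟩

theorem hasFinitelyManyOrbits_top_of_finite {Y : Type*} [MulAction G Y]
    [Finite (MulAction.orbitRel.Quotient G Y)] : HasFinitelyManyOrbits (⊤ : Subgroup G) Y := by
  refine ⟨Set.range (Quotient.out : MulAction.orbitRel.Quotient G Y → Y), Set.finite_range _,
    fun y => ⟨_, ⟨Quotient.mk'' y, rfl⟩, ?_⟩⟩
  obtain ⟨g, hg⟩ := MulAction.orbitRel_apply.1
    (Quotient.eq''.1 (Quotient.out_eq (Quotient.mk'' y : MulAction.orbitRel.Quotient G Y)).symm)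
  exact ⟨g, trivial, hg⟩

theorem HasFinitelyManyOrbits.of_pairs {D : Subgroup G}
    (h : HasFinitelyManyOrbits D (Fin 2 → X)) : HasFinitelyManyOrbits D X := by
  obtain ⟨F, hF, h⟩ := h
  refine ⟨(fun f => f 0) '' F, hF.image _, fun y => ?_⟩
  obtain ⟨f, hf, d, hd, he⟩ := h ![y, y]
  exact ⟨f 0, ⟨f, hf, rfl⟩, d, hd, congrFun he 0⟩

variable (G X) in
/-- If there are finitely many orbits of pairs, then the numbers of orbits of normal subgroups are
bounded. -/
theorem exists_bound_card_orbits [Finite (MulAction.orbitRel.Quotient G (Fin 2 → X))] :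
    ∃ K : ℕ, ∀ P : Subgroup G, P.Normal → HasFinitelyManyOrbits P X →
      ∃ F : Finset X, F.card ≤ K ∧ ∀ y, ∃ f ∈ F, ∃ p ∈ P, p • f = y := by
  classical
  -- A bound is chosen for each set `T` of pair orbits, before any `P` is given; finitely many `T`
  -- then give a uniform bound. The value 0 is used only when no finite `F` exists for `T`.
  have key : ∀ T : Set (MulAction.orbitRel.Quotient G (Fin 2 → X)), ∃ n : ℕ,
      (∃ F : Finset X, ∀ y, ∃ f ∈ F, Quotient.mk'' ![f, y] ∈ T) →
      ∃ F : Finset X, F.card ≤ n ∧ ∀ y, ∃ f ∈ F, Quotient.mk'' ![f, y] ∈ T := fun T => by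
    by_cases h : ∃ F : Finset X, ∀ y, ∃ f ∈ F, Quotient.mk'' ![f, y] ∈ T
    · exact ⟨h.choose.card, fun _ => ⟨h.choose, le_rfl, h.choose_spec⟩⟩
    · exact ⟨0, fun h' => absurd h' h⟩
  choose n hn using key
  obtain ⟨K, hK⟩ := (Set.finite_range n).bddAbove
  refine ⟨K, fun P hP hPX => ?_⟩
  have hr : ∀ (g : G) (x y : X), (∃ p ∈ P, p • x = y) → ∃ p ∈ P, p • g • x = g • y := by
    rintro g x _ ⟨p, hp, rfl⟩
    exact ⟨g * p * g⁻¹, hP.conj_mem p hp g, by simp [mul_smul]⟩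
  have hmem := mk_mem_pairOrbits_iff hr
  obtain ⟨F₀, hF₀, h₀⟩ := hPX
  obtain ⟨F, hF, hFX⟩ := hn (pairOrbits G fun x y => ∃ p ∈ P, p • x = y) ⟨hF₀.toFinset, fun y => by
    obtain ⟨f, hf, hfy⟩ := h₀ y
    exact ⟨f, hF₀.mem_toFinset.2 hf, (hmem f y).2 hfy⟩⟩
  refine ⟨F, hF.trans (hK ⟨_, rfl⟩), fun y => ?_⟩
  obtain ⟨f, hf, hfy⟩ := hFX y
  exact ⟨f, hf, (hmem f y).1 hfy⟩

end PairOrbits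

/-! ### Subgroups generated by parts of a commuting system -/

section CommutingSystem

variable {G : Type*} [Group G] {Ω : Type*} {R : Ω → Subgroup G}

/-- The subgroup generated by the subgroups `R v` for `v` in `S`. -/
def supOver (R : Ω → Subgroup G) (S : Finset Ω) : Subgroup G := ⨆ v ∈ S, R v

theorem le_supOver {S : Finset Ω} {v : Ω} (hv : v ∈ S) : R v ≤ supOver R S :=
  le_iSup₂ (f := fun v (_ : v ∈ S) => R v) v hv

theorem supOver_mono {S T : Finset Ω} (h : S ⊆ T) : supOver R S ≤ supOver R T :=
  iSup₂_le fun _ hv => le_supOver (h hv)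

theorem supOver_union [DecidableEq Ω] (S T : Finset Ω) :
    supOver R (S ∪ T) = supOver R S ⊔ supOver R T := by
  refine le_antisymm (iSup₂_le fun v hv => ?_)
    (sup_le (supOver_mono Finset.subset_union_left) (supOver_mono Finset.subset_union_right))
  rcases Finset.mem_union.1 hv with h | h
  · exact (le_supOver h).trans le_sup_left
  · exact (le_supOver h).trans le_sup_right

theorem supOver_insert [DecidableEq Ω] (v : Ω) (S : Finset Ω) :
    supOver R (insert v S) = R v ⊔ supOver R S :=
  Finset.iSup_insert v S R

theorem supOver_empty : supOver R ∅ = ⊥ := by simp [supOver]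

theorem supOver_univ [Fintype Ω] : supOver R Finset.univ = ⨆ v, R v := by simp [supOver]

theorem supOver_commute (hR : ∀ v w, v ≠ w → ∀ a ∈ R v, ∀ b ∈ R w, a * b = b * a)
    {S T : Finset Ω} (hST : Disjoint S T) {a b : G} (ha : a ∈ supOver R S) (hb : b ∈ supOver R T) :
    a * b = b * a := by
  have h : supOver R S ≤ Subgroup.centralizer (supOver R T) := by
    refine iSup₂_le fun v hv => Subgroup.le_centralizer_iff.1 (iSup₂_le fun w hw b hb => ?_)
    exact Subgroup.mem_centralizer_iff.2 fun a ha =>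
      hR v w (fun h => Finset.disjoint_left.1 hST hv (h ▸ hw)) a ha b hb
  exact ((Subgroup.mem_centralizer_iff.1 (h ha)) b hb).symm

theorem supOver_conj_mem [MulAction G Ω] [DecidableEq Ω]
    (hconj : ∀ (g : G) v, ∀ a ∈ R v, g * a * g⁻¹ ∈ R (g • v)) (g : G) {S : Finset Ω} {a : G}
    (ha : a ∈ supOver R S) : g * a * g⁻¹ ∈ supOver R (S.image (g • ·)) := by
  have h : supOver R S ≤ (supOver R (S.image (g • ·))).comap (MulAut.conj g).toMonoidHom :=
    iSup₂_le fun v hv a ha => le_supOver (Finset.mem_image_of_mem _ hv) (hconj g v a ha)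
  exact h ha

theorem supOver_univ_normal [MulAction G Ω] [Fintype Ω]
    (hconj : ∀ (g : G) v, ∀ a ∈ R v, g * a * g⁻¹ ∈ R (g • v)) :
    (supOver R Finset.univ).Normal := by
  classical
  exact ⟨fun a ha g => supOver_mono (Finset.subset_univ _) (supOver_conj_mem hconj g ha)⟩

/-- An element of the full product splits into a part over `S` and a part over the complement, and
the latter centralises `supOver R S`. -/
theorem supOver_conj_mem_of_mem_univ [Fintype Ω]
    (hR : ∀ v w, v ≠ w → ∀ a ∈ R v, ∀ b ∈ R w, a * b = b * a) {S : Finset Ω} {p a : G}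
    (hp : p ∈ supOver R Finset.univ) (ha : a ∈ supOver R S) : p * a * p⁻¹ ∈ supOver R S := by
  classical
  rw [← Finset.union_compl S, supOver_union] at hp
  obtain ⟨b, hb, c, hc, rfl⟩ :=
    exists_mul_eq_of_mem_sup (fun x hx y hy => supOver_commute hR disjoint_compl_right hx hy) hp
  have h := supOver_commute hR disjoint_compl_right ha hc
  have : b * c * a * (b * c)⁻¹ = b * a * b⁻¹ := by
    rw [mul_assoc b, ← h]
    group
  rw [this]
  exact mul_mem (mul_mem hb ha) (inv_mem hb)

theorem IsCoarselyDense.supOver (hR : ∀ v w, v ≠ w → ∀ a ∈ R v, ∀ b ∈ R w, a * b = b * a)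
    {D : Ω → Subgroup G} (hD : ∀ v, D v ≤ R v) (h : ∀ v, IsCoarselyDense (D v) (R v))
    (S : Finset Ω) : IsCoarselyDense (supOver D S) (supOver R S) := by
  classical
  induction S using Finset.induction_on with
  | empty =>
    rw [supOver_empty, supOver_empty]
    exact ⟨{1}, Set.finite_singleton 1, fun p hp => ⟨p, hp, 1, rfl, mul_one p⟩⟩
  | insert v S hv ih =>
    rw [supOver_insert, supOver_insert]
    refine IsCoarselyDense.sup (fun a ha b hb => ?_) (hD v)
      (iSup₂_mono fun w _ => hD w) (h v) ih
    exact supOver_commute hR (Finset.disjoint_singleton_left.2 hv)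
      (le_supOver (Finset.mem_singleton_self v) ha) hb

/-- The images of the `D v` in the permutation group of `X` centralise one another: for distinct
indices already in `G`, for equal ones by `h`. -/
theorem supOver_commute_smul {X : Type*} [MulAction G X]
    (hR : ∀ v w, v ≠ w → ∀ a ∈ R v, ∀ b ∈ R w, a * b = b * a)
    {D : Ω → Subgroup G} (hD : ∀ v, D v ≤ R v)
    (h : ∀ v, ∀ c ∈ D v, ∀ d ∈ D v, ∀ x : X, c • d • x = d • c • x) (S : Finset Ω) :
    ∀ c ∈ supOver D S, ∀ d ∈ supOver D S, ∀ x : X, c • d • x = d • c • x := by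
  let φ := MulAction.toPermHom G X
  have hφ : ∀ {c d : G}, φ c * φ d = φ d * φ c ↔ ∀ x : X, c • d • x = d • c • x := fun {c d} =>
    Equiv.ext_iff
  have hle : ∀ v ∈ S, ∀ w ∈ S, D v ≤ (Subgroup.centralizer ((D w).map φ : Set _)).comap φ := by
    intro v _ w _ c hc
    refine Subgroup.mem_comap.2 (Subgroup.mem_centralizer_iff.2 ?_)
    rintro _ ⟨d, hd, rfl⟩
    refine hφ.2 fun x => ?_
    by_cases hvw : v = w
    · subst hvw
      exact h v d hd c hc x
    · rw [smul_smul, smul_smul, hR v w hvw c (hD v hc) d (hD w hd)]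
  have hle' : ∀ v ∈ S, ∀ d ∈ supOver D S, ∀ c ∈ D v, φ c * φ d = φ d * φ c := by
    intro v hv d hd c hc
    have : supOver D S ≤ (Subgroup.centralizer ((D v).map φ : Set _)).comap φ :=
      iSup₂_le fun w hw => hle w hw v hv
    exact Subgroup.mem_centralizer_iff.1 (this hd) _ ⟨c, hc, rfl⟩
  intro c hc d hd
  refine hφ.1 ?_
  have : supOver D S ≤ (Subgroup.centralizer {φ d}).comap φ := iSup₂_le fun v hv c hc =>
    Subgroup.mem_comap.2 (Subgroup.mem_centralizer_singleton_iff.2 (hle' v hv d hd c hc))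
  exact Subgroup.mem_centralizer_singleton_iff.1 (this hc)

/-- If there are `r` orbits of pairs, then points in the same orbit of `supOver R univ` are related
by elements supported on at most `r` indices. -/
theorem exists_card_le_of_mem_supOver_univ {X : Type*} [MulAction G X] [MulAction G Ω] [Fintype Ω]
    [Finite (MulAction.orbitRel.Quotient G (Fin 2 → X))]
    (hconj : ∀ (g : G) v, ∀ a ∈ R v, g * a * g⁻¹ ∈ R (g • v))
    (hR : ∀ v w, v ≠ w → ∀ a ∈ R v, ∀ b ∈ R w, a * b = b * a)
    {p : G} (hp : p ∈ supOver R Finset.univ) (x : X) :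
    ∃ S : Finset Ω, S.card ≤ Nat.card (MulAction.orbitRel.Quotient G (Fin 2 → X)) ∧
      ∃ a ∈ supOver R S, a • x = p • x := by
  classical
  -- `E j` relates points joined by an element supported on at most `j` indices. These relations are
  -- invariant and increasing, and each is `E 1` composed with its predecessor, so the chain is
  -- constant once two consecutive terms agree. With `r` pair orbits this happens by step `r`.
  let E : ℕ → X → X → Prop := fun j x y =>
    ∃ S : Finset Ω, S.card ≤ j ∧ ∃ a ∈ supOver R S, a • x = y
  have hE : ∀ j (g : G) x y, E j x y → E j (g • x) (g • y) := by
    rintro j g x _ ⟨S, hS, a, ha, rfl⟩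
    exact ⟨S.image (g • ·), Finset.card_image_le.trans hS, g * a * g⁻¹,
      supOver_conj_mem hconj g ha, by simp [mul_smul]⟩
  have hmono : ∀ {i j}, i ≤ j → ∀ x y, E i x y → E j x y := by
    rintro i j hij x y ⟨S, hS, h⟩
    exact ⟨S, hS.trans hij, h⟩
  have hstep : ∀ j x y, E (j + 1) x y ↔ ∃ z, E j x z ∧ E 1 z y := by
    refine fun j x y => ⟨?_, ?_⟩
    · rintro ⟨S, hS, a, ha, rfl⟩
      rcases S.eq_empty_or_nonempty with rfl | ⟨v, hv⟩
      · exact ⟨a • x, ⟨∅, by simp, a, ha, rfl⟩, ∅, by simp, 1, one_mem _, one_smul _ _⟩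
      · rw [← Finset.insert_erase hv, supOver_insert] at ha
        obtain ⟨b, hb, c, hc, rfl⟩ := exists_mul_eq_of_mem_sup (fun b hb c hc =>
          supOver_commute hR (Finset.disjoint_singleton_left.2 (Finset.notMem_erase v S))
            (le_supOver (Finset.mem_singleton_self v) hb) hc) ha
        refine ⟨c • x, ⟨S.erase v, ?_, c, hc, rfl⟩, {v}, by simp, b,
          le_supOver (Finset.mem_singleton_self v) hb, (mul_smul _ _ _).symm⟩
        rw [Finset.card_erase_of_mem hv]
        omega
    · rintro ⟨_, ⟨S, hS, a, ha, rfl⟩, T, hT, b, hb, rfl⟩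
      refine ⟨T ∪ S, (Finset.card_union_le _ _).trans (by omega), b * a, ?_, mul_smul _ _ _⟩
      exact mul_mem (supOver_mono Finset.subset_union_left hb)
        (supOver_mono Finset.subset_union_right ha)
  let f : ℕ → ℕ := fun j => (pairOrbits G (E j)).ncard
  have hfmono : Monotone f := fun i j hij =>
    Set.ncard_le_ncard (pairOrbits_mono (hmono hij)) (Set.toFinite _)
  have hf : ∀ {i j}, i ≤ j → f i = f j → ∀ x y, E j x y → E i x y := by
    intro i j hij h x y hxy
    have := Set.eq_of_subset_of_ncard_le (pairOrbits_mono (G := G) (hmono hij)) h.ge (Set.toFinite _)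
    rw [← mk_mem_pairOrbits_iff (hE i), this, mk_mem_pairOrbits_iff (hE j)]
    exact hxy
  set r := Nat.card (MulAction.orbitRel.Quotient G (Fin 2 → X)) with hr
  have hle : ∀ j, f j ≤ r := fun j => by
    rw [hr, ← Set.ncard_univ]
    exact Set.ncard_le_ncard (Set.subset_univ _) (Set.toFinite _)
  have hstab : ∀ m, f m = f (m + 1) → f (m + 1) = f (m + 2) := by
    intro m hm
    refine le_antisymm (hfmono (Nat.le_succ _)) (Set.ncard_le_ncard (pairOrbits_mono ?_)
      (Set.toFinite _))
    intro x y h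
    obtain ⟨z, hz, hzy⟩ := (hstep (m + 1) x y).1 h
    exact (hstep m x y).2 ⟨z, hf (Nat.le_succ m) hm x z hz, hzy⟩
  -- All of `Ω` is an admissible support at this stage; the maximum keeps the stage at or beyond
  -- `r`, where the chain is constant.
  have hall : E (max r (Fintype.card Ω)) x (p • x) :=
    ⟨Finset.univ, le_max_right _ _, p, hp, rfl⟩
  exact hf (le_max_left _ _)
    (Nat.stabilises_of_monotone hfmono hle hstab (le_max_left _ _)).symm x _ hall

/-- There are boundedly many of the subgroups `R v` which generate a subgroup with finitely many
orbits. -/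
theorem exists_supOver_hasFinitelyManyOrbits {X : Type*} [MulAction G X] [MulAction G Ω]
    [Fintype Ω] [Finite (MulAction.orbitRel.Quotient G (Fin 2 → X))]
    (hconj : ∀ (g : G) v, ∀ a ∈ R v, g * a * g⁻¹ ∈ R (g • v))
    (hR : ∀ v w, v ≠ w → ∀ a ∈ R v, ∀ b ∈ R w, a * b = b * a)
    (F : Finset X) (hF : ∀ y, ∃ f ∈ F, ∃ p ∈ supOver R Finset.univ, p • f = y) :
    ∃ S : Finset Ω, S.card ≤ F.card * Nat.card (MulAction.orbitRel.Quotient G (Fin 2 → X)) ∧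
      HasFinitelyManyOrbits (supOver R S) X := by
  classical
  set r := Nat.card (MulAction.orbitRel.Quotient G (Fin 2 → X)) with hr
  have hpoint : ∀ x : X, ∃ S : Finset Ω, S.card ≤ r ∧ ∃ F : Set X, F.Finite ∧
      ∀ p ∈ supOver R Finset.univ, ∃ f ∈ F, ∃ a ∈ supOver R S, a • f = p • x := by
    intro x
    -- The covering argument is run inside the full product, where `supOver R S` is normal; it need
    -- not be normal in `G`.
    have hN : ∀ S : Finset Ω, ((supOver R S).subgroupOf (supOver R Finset.univ)).Normal :=
      fun S => ⟨fun a ha p => supOver_conj_mem_of_mem_univ hR p.2 ha⟩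
    obtain ⟨S, hS, F, hF, h⟩ := exists_orbit_finite_cover
      (Finset.univ.filter fun S : Finset Ω => S.card ≤ r)
      (fun S => (supOver R S).subgroupOf (supOver R Finset.univ)) x fun p => by
        obtain ⟨S, hS, a, ha, hax⟩ := exists_card_le_of_mem_supOver_univ hconj hR p.2 x
        exact ⟨S, by simpa using hS, ⟨a, supOver_mono (Finset.subset_univ S) ha⟩, ha, hax⟩
    refine ⟨S, by simpa using hS, F, hF, fun p hp => ?_⟩
    obtain ⟨f, hf, a, ha, hax⟩ := h ⟨p, hp⟩
    exact ⟨f, hf, a.1, ha, hax⟩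
  choose S hS F' hF' h using hpoint
  refine ⟨F.biUnion S, Finset.card_biUnion_le_card_mul _ _ _ fun x _ => hS x,
    ⋃ x ∈ F, F' x, F.finite_toSet.biUnion fun x _ => hF' x, fun y => ?_⟩
  obtain ⟨x, hx, p, hp, rfl⟩ := hF y
  obtain ⟨f, hf, a, ha, hax⟩ := h x p hp
  exact ⟨f, Set.mem_biUnion hx hf, a, supOver_mono (Finset.subset_biUnion_of_mem S hx) ha, hax⟩

theorem HasFinitelyManyOrbits.supOver_image {X : Type*} [MulAction G X] [MulAction G Ω]
    [DecidableEq Ω] (hconj : ∀ (g : G) v, ∀ a ∈ R v, g * a * g⁻¹ ∈ R (g • v)) (g : G)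
    {S : Finset Ω} (h : HasFinitelyManyOrbits (supOver R S) X) :
    HasFinitelyManyOrbits (supOver R (S.image (g • ·))) X := by
  obtain ⟨F, hF, h⟩ := h
  refine ⟨(g • ·) '' F, hF.image _, fun y => ?_⟩
  obtain ⟨f, hf, a, ha, hax⟩ := h (g⁻¹ • y)
  exact ⟨g • f, Set.mem_image_of_mem _ hf, g * a * g⁻¹, supOver_conj_mem hconj g ha,
    by simp [mul_smul, hax]⟩

/-- A group with arbitrarily large finite transitive systems of commuting subgroups that generate
subgroups of finite index has infinitely many orbits on the pairs of elements of an infinite set. -/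
theorem not_finite_of_commuting_systems {X : Type*} [MulAction G X] [Infinite X]
    (Ω : ℕ → Type*) [∀ n, Finite (Ω n)] [∀ n, MulAction G (Ω n)]
    [∀ n, MulAction.IsPretransitive G (Ω n)] (R : ∀ n, Ω n → Subgroup G)
    (hconj : ∀ n (g : G) v, ∀ a ∈ R n v, g * a * g⁻¹ ∈ R n (g • v))
    (hR : ∀ n v w, v ≠ w → ∀ a ∈ R n v, ∀ b ∈ R n w, a * b = b * a)
    (hfin : ∀ n, (⨆ v, R n v).FiniteIndex) (hcard : ∀ N : ℕ, ∃ n, N < Nat.card (Ω n)) :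
    ¬ Finite (MulAction.orbitRel.Quotient G (Fin 2 → X)) := by
  classical
  intro hX
  obtain ⟨K, hK⟩ := exists_bound_card_orbits G X
  set C := K * Nat.card (MulAction.orbitRel.Quotient G (Fin 2 → X)) with hC
  -- A translate of `S` will have to avoid `v` together with another translate: at most `C` points
  -- against at most `C + 1`.
  obtain ⟨n, hn⟩ := hcard (C * (C + 1))
  have := Fintype.ofFinite (Ω n)
  have hR := hR n
  have hconj := hconj n
  have hP : IsCoarselyDense (supOver (R n) Finset.univ) ⊤ := by
    rw [supOver_univ]
    have := hfin n
    exact isCoarselyDense_top_of_finiteIndex _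
  have htop : HasFinitelyManyOrbits (⊤ : Subgroup G) (Fin 2 → X) :=
    hasFinitelyManyOrbits_top_of_finite
  obtain ⟨F, hF, hFX⟩ := hK _ (supOver_univ_normal hconj)
    (hP.hasFinitelyManyOrbits htop).of_pairs
  obtain ⟨S, hS, hSX⟩ := exists_supOver_hasFinitelyManyOrbits hconj hR F hFX
  replace hS : S.card ≤ C := hS.trans (Nat.mul_le_mul_right _ hF)
  have hv : ∀ v : Ω n, ∃ D ≤ R n v, IsCoarselyDense D (R n v) ∧
      ∀ c ∈ D, ∀ d ∈ D, ∀ x : X, c • d • x = d • c • x := by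
    intro v
    obtain ⟨g, hg⟩ := exists_smul_disjoint_of_card_lt (G := G) S {v}
      (lt_of_le_of_lt (by rw [Finset.card_singleton]; nlinarith) hn)
    have hcard₂ : (insert v (S.image (g • ·))).card ≤ C + 1 :=
      (Finset.card_insert_le _ _).trans (Nat.succ_le_succ (Finset.card_image_le.trans hS))
    obtain ⟨h, hh⟩ := exists_smul_disjoint_of_card_lt (G := G) S (insert v (S.image (g • ·)))
      (lt_of_le_of_lt (Nat.mul_le_mul hS hcard₂) hn)
    set S₁ := S.image (g • ·)
    set S₂ := S.image (h • ·)
    rw [Finset.disjoint_insert_right] at hh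
    have h₁ : HasFinitelyManyOrbits (supOver (R n) S₁) X := hSX.supOver_image hconj g
    have h₂ : HasFinitelyManyOrbits (supOver (R n) S₂) X := hSX.supOver_image hconj h
    have hvS : R n v ≤ supOver (R n) {v} := le_supOver (Finset.mem_singleton_self v)
    have c₁ : ∀ a ∈ supOver (R n) S₁, ∀ c ∈ R n v, a * c = c * a := fun a ha c hc =>
      supOver_commute hR hg ha (hvS hc)
    have c₂ : ∀ a ∈ supOver (R n) S₂, ∀ c ∈ R n v, a * c = c * a := fun a ha c hc =>
      supOver_commute hR (Finset.disjoint_singleton_right.2 hh.1) ha (hvS hc)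
    have c₃ : ∀ a ∈ supOver (R n) S₁, ∀ b ∈ supOver (R n) S₂, a * b = b * a :=
      fun a ha b hb => supOver_commute hR hh.2.symm ha hb
    have i₁ : orbitPreserving (R n v) (supOver (R n) S₁) X ≤ R n v := fun c hc => hc.1
    have i₂ : orbitPreserving (orbitPreserving (R n v) (supOver (R n) S₁) X)
        (supOver (R n) S₂) X ≤ orbitPreserving (R n v) (supOver (R n) S₁) X := fun c hc => hc.1
    -- `D` consists of the elements of `R n v` that preserve every orbit of both translated
    -- subgroups, obtained by two successive passages to a coarsely dense subgroup.
    refine ⟨_, i₂.trans i₁,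
      (isCoarselyDense_orbitPreserving h₂ fun a ha c hc => c₂ a ha c (i₁ hc)).trans
        (isCoarselyDense_orbitPreserving h₁ c₁), fun c hc d hd x => ?_⟩
    exact commute_smul_of_orbitPreserving c₃ c₁ c₂ ⟨i₁ hc.1, hc.2⟩ hd.1 x
  choose D hDR hD hDc using hv
  -- The group generated by all the `D v` is coarsely dense in `G`, hence has finitely many orbits
  -- on pairs, yet its elements commute on `X`.
  have hfinX := finite_of_commute_smul (supOver_commute_smul hR hDR hDc Finset.univ)
    (((IsCoarselyDense.supOver hR hDR hD Finset.univ).trans hP).hasFinitelyManyOrbits htop)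
  exact not_finite X

end CommutingSystem

/-! ### Automorphisms of rooted trees -/

namespace RootedTree

variable {A : ℕ → Type u}

theorem Word.IsPrefix.refl (x : Word A) : x.IsPrefix x := ⟨le_rfl, fun _ => rfl⟩

theorem Word.IsPrefix.trans {x y z : Word A} (h₁ : x.IsPrefix y) (h₂ : y.IsPrefix z) :
    x.IsPrefix z := by
  obtain ⟨l₁, h₁⟩ := h₁
  obtain ⟨l₂, h₂⟩ := h₂
  exact ⟨l₁.trans l₂, fun i => (h₂ (Fin.castLE l₁ i)).trans (h₁ i)⟩

theorem Word.IsPrefix.eq_of_length_le {x y : Word A} (h : x.IsPrefix y)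
    (hl : y.length ≤ x.length) : x = y := by
  obtain ⟨n, a⟩ := x
  obtain ⟨m, b⟩ := y
  obtain ⟨l, h⟩ := h
  obtain rfl : n = m := le_antisymm l hl
  congr
  funext i
  exact (h i).symm

theorem Word.eq_of_isPrefix {x y z : Word A} (hx : x.IsPrefix z) (hy : y.IsPrefix z)
    (hl : x.length = y.length) : x = y := by
  obtain ⟨n, a⟩ := x
  obtain ⟨m, b⟩ := y
  obtain rfl : n = m := hl
  obtain ⟨_, h⟩ := hx
  obtain ⟨_, h'⟩ := hy
  congr
  funext i
  exact (h i).symm.trans (h' i)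

/-- A word of length `n + 1` is a child of a word of length `n`, of which all its proper prefixes
are prefixes. -/
theorem Word.exists_isChild (y : Word A) {n : ℕ} (hy : y.length = n + 1) :
    ∃ p : Word A, p.length = n ∧ p.IsChild y ∧
      ∀ x : Word A, x.length ≤ n → x.IsPrefix y → x.IsPrefix p := by
  obtain ⟨m, b⟩ := y
  obtain rfl : m = n + 1 := hy
  refine ⟨⟨n, fun i => b i.castSucc⟩, rfl, ⟨⟨n.le_succ, fun _ => rfl⟩, rfl⟩, fun x hx h => ?_⟩
  obtain ⟨l, h⟩ := h
  exact ⟨hx, fun i => h i⟩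

theorem Word.length_eq_zero {x : Word A} (h : x.length = 0) : x = Word.empty := by
  obtain ⟨n, a⟩ := x
  obtain rfl : n = 0 := h
  congr
  funext i
  exact i.elim0

/-- The root is fixed, and the image of a word is adjacent to the image of its parent, so length
grows by at most one per level. Applying this to the inverse as well gives `Aut.length_apply`. -/
theorem Aut.length_apply_le (f : Aut A) (n : ℕ) :
    ∀ x : Word A, x.length = n → (f.1 x).length ≤ n := by
  induction n with
  | zero =>
    intro x hx
    rw [Word.length_eq_zero hx, show f.1 Word.empty = Word.empty from f.2]
    exact le_rfl
  | succ n ih =>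
    intro x hx
    obtain ⟨p, hp, hpx, -⟩ := x.exists_isChild hx
    have hadj : (graph A).Adj (f.1 p) (f.1 x) := f.1.map_adj_iff.2 (Or.inl hpx)
    have := ih p hp
    rcases hadj with h | h
    · have := h.2
      omega
    · have := h.2
      omega

theorem Aut.length_apply (f : Aut A) (x : Word A) : (f.1 x).length = x.length := by
  refine le_antisymm (Aut.length_apply_le f _ x rfl) ?_
  have h := Aut.length_apply_le f⁻¹ _ (f.1 x) rfl
  rwa [show (f⁻¹).1 (f.1 x) = x from f.1.symm_apply_apply x] at h

theorem Aut.isPrefix_apply (f : Aut A) {x y : Word A} (h : x.IsPrefix y) :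
    (f.1 x).IsPrefix (f.1 y) := by
  obtain ⟨n, hn⟩ : ∃ n, y.length = x.length + n := Nat.exists_eq_add_of_le h.1
  induction n generalizing y with
  | zero => rw [h.eq_of_length_le hn.le]; exact .refl _
  | succ n ih =>
    obtain ⟨p, hp, hpy, hxp⟩ := y.exists_isChild (n := x.length + n) hn
    refine (ih (hxp x (by omega) h) hp).trans ?_
    have hadj : (graph A).Adj (f.1 p) (f.1 y) := f.1.map_adj_iff.2 (Or.inl hpy)
    rcases hadj with h' | h'
    · exact h'.1
    -- Preservation of length excludes that the edge is reversed.
    · have h₁ := h'.2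
      have h₂ := hpy.2
      rw [Aut.length_apply, Aut.length_apply] at h₁
      omega

theorem rist_conj_mem {G : Subgroup (Aut A)} (g : G) (v : Word A) {a : G} (ha : a ∈ rist G v) :
    g * a * g⁻¹ ∈ rist G (g.1.1 v) := by
  intro y hy
  change g.1.1 (a.1.1 (g.1.1.symm y)) = y
  rw [ha, g.1.1.apply_symm_apply]
  intro h
  apply hy
  simpa using Aut.isPrefix_apply g.1 h

theorem rist_commute {G : Subgroup (Aut A)} {v w : Word A} (hl : v.length = w.length)
    (hvw : v ≠ w) {a b : G} (ha : a ∈ rist G v) (hb : b ∈ rist G w) : a * b = b * a := by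
  have key : ∀ {v w : Word A}, v.length = w.length → v ≠ w → ∀ {a b : G}, a ∈ rist G v →
      b ∈ rist G w → ∀ y : Word A, ¬ w.IsPrefix y → a.1.1 (b.1.1 y) = b.1.1 (a.1.1 y) := by
    intro v w hl hvw a b ha hb y hy
    rw [hb y hy, hb]
    intro h
    -- If `a` moved `y` below `w`, the image would not be below `v`, so `a` would fix it;
    -- injectivity then puts `y` itself below `w`.
    have h' : a.1.1 (a.1.1 y) = a.1.1 y :=
      ha _ fun hv => hvw (Word.eq_of_isPrefix hv h hl)
    rw [a.1.1.injective h'] at h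
    exact hy h
  refine Subtype.ext (Subtype.ext (RelIso.ext fun y => ?_))
  change a.1.1 (b.1.1 y) = b.1.1 (a.1.1 y)
  by_cases hy : w.IsPrefix y
  · exact (key hl.symm hvw.symm hb ha y fun hv => hvw (Word.eq_of_isPrefix hv hy hl)).symm
  · exact key hl hvw ha hb y hy

/-! ### The levels as finite transitive sets -/

variable (A) in
/-- The words of length `n`. -/
def Level (n : ℕ) : Type u := {x : Word A // x.length = n}

variable (A) in
/-- The words of length `n` as a product of alphabets. -/
def levelEquiv (n : ℕ) : Level A n ≃ (∀ i : Fin n, A i) where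
  toFun x := x.2 ▸ x.1.2
  invFun a := ⟨⟨n, a⟩, rfl⟩
  left_inv := by
    rintro ⟨⟨m, a⟩, h⟩
    obtain rfl : m = n := h
    rfl
  right_inv _ := rfl

instance [∀ i, Finite (A i)] (n : ℕ) : Finite (Level A n) := Finite.of_equiv _ (levelEquiv A n).symm

theorem two_pow_le_card_level [∀ i, Finite (A i)] (hA : ∀ i, 2 ≤ Nat.card (A i)) (n : ℕ) :
    2 ^ n ≤ Nat.card (Level A n) := by
  rw [Nat.card_congr (levelEquiv A n), Nat.card_pi]
  calc 2 ^ n = ∏ _i : Fin n, 2 := by simp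
    _ ≤ _ := Finset.prod_le_prod' fun i _ => hA i

instance (G : Subgroup (Aut A)) (n : ℕ) : MulAction G (Level A n) where
  smul g x := ⟨g.1.1 x.1, (Aut.length_apply g.1 x.1).trans x.2⟩
  one_smul _ := rfl
  mul_smul _ _ _ := rfl

theorem IsSphericallyTransitive.isPretransitive {G : Subgroup (Aut A)}
    (hG : IsSphericallyTransitive G) (n : ℕ) : MulAction.IsPretransitive G (Level A n) where
  exists_smul_eq x y := by
    obtain ⟨g, hg, h⟩ := hG n x.1 y.1 x.2 y.2
    exact ⟨⟨g, hg⟩, Subtype.ext h⟩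

theorem iSup_rist_level (G : Subgroup (Aut A)) (n : ℕ) :
    ⨆ v : Level A n, rist G v.1 = levelRist G n :=
  iSup_subtype

end RootedTree

theorem theoremA {A : ℕ → Type u} [∀ i, Finite (A i)] (hA : ∀ i, 2 ≤ Nat.card (A i))
    (G : Subgroup (RootedTree.Aut A)) (hG : RootedTree.IsBranchGroup G)
    (X : Type v) [Infinite X] [MulAction G X] :
    ¬ IsQuasiTransitive G X 2 := by
  intro hX
  have := fun n => hG.sphericallyTransitive.isPretransitive n
  have := fun n => hG.finiteIndex_levelRist n
  refine not_finite_of_commuting_systems (fun n => RootedTree.Level A n)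
    (fun n v => RootedTree.rist G v.1)
    (fun n g v a ha => RootedTree.rist_conj_mem g v.1 ha)
    (fun n v w hvw a ha b hb => RootedTree.rist_commute (v.2.trans w.2.symm)
      (fun h => hvw (Subtype.ext h)) ha hb)
    (fun n => by rw [RootedTree.iSup_rist_level]; infer_instance)
    (fun N => ⟨N, Nat.lt_two_pow_self.trans_le (RootedTree.two_pow_le_card_level hA N)⟩) hX
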